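/- Let $\mathbf{k}$ be a field of characteristic zero and let $q\in\mathbf{k}$ not be a nontrivial root of unity ($q=1$ and $q=0$ are allowed). Let $n\ge 1$ and $\mathbf{x}_n=(x_1,\dots,x_n)$. For a rational function $F\in\mathbf{k}(\mathbf{x}_n)$ put $$\partial_{w_0}F=\frac{\sum_{\sigma\in\mathbb{S}_n}\operatorname{sgn}(\sigma)\,F(x_{\sigma(1)},\dots,x_{\sigma(n)})}{\prod_{1\le i<j\le n}(x_i-x_j)},$$ and for $f\in\mathbf{k}[\mathbf{x}_n]$ define the $q$-divided symmetrization $$\langle f\rangle_n^q=\partial_{w_0}\Bigl(\prod_{1\le i<j\le n}(qx_i-x_j)\cdot\frac{f}{\prod_{1\le i\le n-1}(qx_i-x_{i+1})}\Bigr).$$ Let $\mathrm{QSym}_n^+$ be the ideal of $\mathbf{k}[\mathbf{x}_n]$ generated by the quasisymmetric polynomials without constant term, where a polynomial is quasisymmetric if for all positive integers $\alpha_1,\dots,\alpha_k$ and all $1\le i_1<\dots<i_k\le n$ its coefficients at $x_{i_1}^{\alpha_1}\cdots x_{i_k}^{\alpha_k}$ and at $x_1^{\alpha_1}\cdots x_k^{\alpha_k}$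 agree. Let $$\mathrm{ABB}_n=\Bigl\{(c_1,\dots,c_n)\in\mathbb{N}^n \;:\; \sum_{i\le j\le n}c_j\le n-i\ \text{ for all }1\le i\le n\Bigr\},$$ and let $L_n$ be the $\mathbf{k}$-linear span of the (Aval–Bergeron–Bergeron) monomials $\mathbf{x}^c$ with $c\in \mathrm{ABB}_n$. (1) If $f\in\mathbf{k}[\mathbf{x}_n]$, homogeneous of degree $n-1$, is written $f=g+h$ with $g\in L_n$ and $h\in\mathrm{QSym}_n^+$, then $$\langle f\rangle_n^q=g(1,q,q^2,\dots,q^{n-1}).$$ (2) If $c\in\mathrm{ABB}_n$ and $c_1+\dots+c_n=n-1$ (so that $c_n=0$), then $$\langle \mathbf{x}^c\rangle_n^q=q^{\mathrm{coarea}(\mathsf{Dyck}(c))}.$$ Here $\mathsf{Dyck}(c)$ is the Dyck path $N^{c_1}E\,N^{c_2}E\cdots N^{c_{n-1}}E$ from $(0,0)$ to $(n-1,n-1)$ with unit north steps $N$ and unit east steps $E$, which stays weakly above the diagonal. Its coarea is $\binom{n-1}{2}$ minus the number of unit cells lying between the path and the diagonal, that is, the number of unit cells of the square $[0,n-1]^2$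 that lie above the path. -/

import Mathlib

open MvPolynomial Finset

noncomputable section

/-- The field of rational functions `K(x₁, …, xₙ)`; the variable `xᵢ₊₁` of the literature is
`X i` for `i : Fin n`. -/
abbrev RatFun (K : Type*) [Field K] (n : ℕ) : Type _ :=
  FractionRing (MvPolynomial (Fin n) K)

/-- The `i`-th variable as a rational function. -/
def ratX (K : Type*) [Field K] {n : ℕ} (i : Fin n) : RatFun K n :=
  algebraMap (MvPolynomial (Fin n) K) (RatFun K n) (X i)

/-- The action of the symmetric group on rational functions by permuting the variables,
`xᵢ ↦ x_{σ(i)}`. -/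
def permAct (K : Type*) [Field K] {n : ℕ} (σ : Equiv.Perm (Fin n)) :
    RatFun K n ≃+* RatFun K n :=
  IsFractionRing.ringEquivOfRingEquiv (renameEquiv K σ).toRingEquiv

/-- The divided difference operator `∂_{w₀}` of the longest permutation: antisymmetrization
followed by division by the Vandermonde determinant `∏_{i<j} (xᵢ - xⱼ)`. -/
def dividedDiffLongest {K : Type*} [Field K] {n : ℕ} (F : RatFun K n) : RatFun K n :=
  (∑ σ : Equiv.Perm (Fin n), ((Equiv.Perm.sign σ : ℤ) : RatFun K n) * permAct K σ F) /
    ∏ i : Fin n, ∏ j ∈ Ioi i, (ratX K i - ratX K j)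

/-- The linear form `q xᵢ - xⱼ`, as a rational function. -/
def qForm {K : Type*} [Field K] (q : K) {n : ℕ} (i j : Fin n) : RatFun K n :=
  algebraMap (MvPolynomial (Fin n) K) (RatFun K n) (C q * X i - X j)

/-- The operator `□_{w₀} = ∂_{w₀} ∘ ∏_{i<j} (q xᵢ - xⱼ)` (first multiply, then apply
`∂_{w₀}`) on rational functions. -/
def squareLongest {K : Type*} [Field K] (q : K) {n : ℕ} (F : RatFun K n) : RatFun K n :=
  dividedDiffLongest ((∏ i : Fin n, ∏ j ∈ Ioi i, qForm q i j) * F)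

/-- The `q`-divided symmetrization `⟨f⟩_n^q = □_{w₀} (f / ∏_{1 ≤ i ≤ n-1} (q xᵢ - xᵢ₊₁))` of a
polynomial `f` in `n` variables. -/
def qds {K : Type*} [Field K] (q : K) {n : ℕ} (f : MvPolynomial (Fin n) K) : RatFun K n :=
  squareLongest q
    (algebraMap (MvPolynomial (Fin n) K) (RatFun K n) f /
      ∏ i : Fin (n - 1), qForm q (⟨i, by omega⟩ : Fin n) ⟨i + 1, by omega⟩)

/-- A polynomial in `x₁, …, xₙ` is quasisymmetric if for all positive `α₁, …, α_k` the
coefficient of `x_{i₁}^{α₁} ⋯ x_{i_k}^{α_k}`, where `i₁ < ⋯ < i_k`, equals that of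
`x₁^{α₁} ⋯ x_k^{α_k}`. -/
def IsQuasisymmetric {K : Type*} [Field K] {n : ℕ} (p : MvPolynomial (Fin n) K) : Prop :=
  ∀ (k : ℕ) (hk : k ≤ n) (α : Fin k → ℕ), (∀ j, 0 < α j) →
    ∀ i : Fin k → Fin n, StrictMono i →
      coeff (∑ j, Finsupp.single (i j) (α j)) p =
        coeff (∑ j, Finsupp.single (Fin.castLE hk j) (α j)) p

/-- The ideal `QSym_n^+` of `K[x₁, …, xₙ]` generated by the quasisymmetric polynomials without
constant term. -/
def qsymPlus (K : Type*) [Field K] (n : ℕ) : Ideal (MvPolynomial (Fin n) K) :=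
  Ideal.span {p | IsQuasisymmetric p ∧ constantCoeff p = 0}

/-- The exponent vectors of the Aval–Bergeron–Bergeron monomials:
`c_i + ⋯ + c_n ≤ n - i` for `1 ≤ i ≤ n` (here `i` is counted from `0`). -/
def abbSet (n : ℕ) : Set (Fin n →₀ ℕ) :=
  {c | ∀ i : Fin n, ∑ j ∈ Ici i, c j ≤ n - (i + 1)}

/-- The span `L_n` of the Aval–Bergeron–Bergeron monomials. -/
def abbSpan (K : Type*) [Field K] (n : ℕ) : Submodule K (MvPolynomial (Fin n) K) :=
  Submodule.span K ((fun c => monomial c (1 : K)) '' abbSet n)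

/-- The lattice word `N^{d₀} E N^{d₁} E ⋯ N^{d_{m-1}} E`, where a north step is written `U` and
an east step is written `D`. -/
def stepWord (d : ℕ → ℕ) (m : ℕ) : List DyckStep :=
  (List.range m).flatMap fun i => List.replicate (d i) DyckStep.U ++ [DyckStep.D]

theorem stepWord_succ (d : ℕ → ℕ) (m : ℕ) :
    stepWord d (m + 1) =
      stepWord d m ++ (List.replicate (d m) DyckStep.U ++ [DyckStep.D]) := by
  simp [stepWord, List.range_succ]

theorem stepWord_count_D (d : ℕ → ℕ) (m : ℕ) : (stepWord d m).count DyckStep.D = m := by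
  induction m with
  | zero => simp [stepWord]
  | succ m ih => simp [stepWord_succ, ih, List.count_replicate]

theorem stepWord_count_U (d : ℕ → ℕ) (m : ℕ) :
    (stepWord d m).count DyckStep.U = ∑ i ∈ range m, d i := by
  induction m with
  | zero => simp [stepWord]
  | succ m ih => simp [stepWord_succ, ih, Finset.sum_range_succ]

theorem stepWord_prefix (d : ℕ → ℕ) (m : ℕ) (hd : ∀ j ≤ m, j ≤ ∑ i ∈ range j, d i) (p : ℕ) :
    ((stepWord d m).take p).count DyckStep.D ≤ ((stepWord d m).take p).count DyckStep.U := by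
  induction m generalizing p with
  | zero => simp [stepWord]
  | succ m ih =>
    have ih' := ih (fun j hj => hd j (by omega))
    rcases le_or_gt p (stepWord d m).length with hp | hp
    · rw [stepWord_succ, List.take_append_of_le_length hp]
      exact ih' p
    · rw [stepWord_succ, List.take_append, List.take_of_length_le hp.le, List.count_append,
        List.count_append, stepWord_count_D, stepWord_count_U]
      have h1 := hd m (by omega)
      have h2 := hd (m + 1) le_rfl
      rw [Finset.sum_range_succ] at h2
      generalize p - (stepWord d m).length = t
      rcases le_or_gt t (d m) with ht | ht
      · rw [List.take_append_of_le_length (by simpa using ht)]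
        simp [List.take_replicate, List.count_replicate]
        omega
      · rw [List.take_of_length_le (by simp; omega)]
        simp [List.count_replicate]
        omega

/-- A vector `(c₁, …, cₙ)` extended by zeros, indexed from `0`. -/
def extendZero {n : ℕ} (c : Fin n →₀ ℕ) (i : ℕ) : ℕ :=
  if h : i < n then c ⟨i, h⟩ else 0

theorem sum_extendZero_add {n : ℕ} (c : Fin n →₀ ℕ) (i : Fin n) :
    ∑ j ∈ range i, extendZero c j + ∑ j ∈ Ici i, c j = ∑ j, c j := by
  have h1 : ∑ j, c j = ∑ j ∈ range n, extendZero c j := by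
    rw [Finset.sum_range]
    exact Finset.sum_congr rfl fun j _ => by simp [extendZero]
  have h2 : ∑ j ∈ Ici i, c j = ∑ j ∈ Ico (i : ℕ) n, extendZero c j := by
    refine Finset.sum_bij (fun j _ => (j : ℕ)) ?_ ?_ ?_ ?_
    · intro j hj
      simp only [Finset.mem_Ici, Fin.le_def] at hj
      simp [hj]
    · intro a _ b _ h
      exact Fin.ext h
    · intro b hb
      simp only [Finset.mem_Ico] at hb
      exact ⟨⟨b, hb.2⟩, by simpa [Fin.le_def] using hb.1, rfl⟩
    · intro j _
      simp [extendZero]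
  rw [h1, h2, Finset.sum_range_add_sum_Ico _ i.2.le]

theorem abbSet_prefix {n : ℕ} {c : Fin n →₀ ℕ} (hc : c ∈ abbSet n)
    (hdeg : ∑ i, c i = n - 1) {j : ℕ} (hj : j ≤ n - 1) :
    j ≤ ∑ i ∈ range j, extendZero c i := by
  rcases Nat.eq_zero_or_pos n with rfl | hn
  · omega
  · have h1 := sum_extendZero_add c ⟨j, by omega⟩
    have h2 := hc ⟨j, by omega⟩
    simp only at h1 h2
    omega

theorem abbSet_total {n : ℕ} {c : Fin n →₀ ℕ} (hc : c ∈ abbSet n)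
    (hdeg : ∑ i, c i = n - 1) : ∑ i ∈ range (n - 1), extendZero c i = n - 1 := by
  rcases Nat.eq_zero_or_pos n with rfl | hn
  · simp
  · have h1 := sum_extendZero_add c ⟨n - 1, by omega⟩
    have h2 := hc ⟨n - 1, by omega⟩
    simp only at h1 h2
    omega

/-- The Dyck path `N^{c₁} E N^{c₂} E ⋯ N^{c_{n-1}} E` from `(0,0)` to `(n-1,n-1)`, weakly above
the diagonal, attached to the exponent vector `c` of an Aval–Bergeron–Bergeron monomial of degree
`n - 1` (for which `cₙ = 0`). North steps are `U`, east steps are `D`. -/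
def abbDyck {n : ℕ} (c : Fin n →₀ ℕ) (hc : c ∈ abbSet n) (hdeg : ∑ i, c i = n - 1) :
    DyckWord where
  toList := stepWord (extendZero c) (n - 1)
  count_U_eq_count_D := by
    rw [stepWord_count_D, stepWord_count_U, abbSet_total hc hdeg]
  count_D_le_count_U p :=
    stepWord_prefix _ _ (fun _ hj => abbSet_prefix hc hdeg hj) p

/-- The complementary area of a Dyck path `w` from `(0,0)` to `(m,m)`: the number of those of the
`m(m-1)/2` unit cells `[a,a+1] × [b,b+1]`, `0 ≤ a < b < m`, above the diagonal that do not lie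
between the path and the diagonal. These are the cells above the path, that is, the path visits
a lattice point weakly to the south-east of the corner `(a+1,b)`. -/
def coarea (w : DyckWord) : ℕ :=
  #{x ∈ range w.semilength ×ˢ range w.semilength | x.1 < x.2 ∧
    ∃ p ∈ range (w.toList.length + 1),
      x.1 + 1 ≤ (w.toList.take p).count DyckStep.D ∧
        (w.toList.take p).count DyckStep.U ≤ x.2}

end

/-! Write x_0, …, x_n for the variables and R_p for substituting 0 in slot p and relabelling. The
proof passes through T_k f = (R_{k+1} f - R_k f) / x_k (`trim`) and the functional Λ = (∑ q^k T_k)^n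
(`trimFunctional`). Λ is the symmetrization in degree n (`altSum_eq_trimFunctional`,
`qds_eq_trimFunctional`). After cancelling the adjacent factors, the antisymmetrized polynomial has
the degree of the Vandermonde product, so it is a scalar multiple of it, and setting x_0 = 0 detects
the scalar. Sorting permutations by the position of that 0 and summing by parts reproduces the same
problem for ∑ q^k T_k f, with one variable less. Λ kills `qsymPlus` (`trimFunctional_eq_zero`),
because each T_k is linear over quasisymmetric polynomials. On degree n combinations of ABB
monomials, Λ is evaluation at (1, q, …, q^n) (`trimFunctional_eq_eval`): since q^k is the value of
x_k, the sum of the q^k T_k telescopes. At a single monomial this value is the power of q counted by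
the coarea (`coarea_abbDyck`). -/

noncomputable section

/-! ### Quasisymmetric divided differences and the functional they generate -/

/-- The algebra homomorphism `f ↦ f(x₀, …, x_{p-1}, 0, x_p, …, x_{n-1})`. -/
def insertZero (K : Type*) [Field K] {n : ℕ} (p : Fin (n + 1)) :
    MvPolynomial (Fin (n + 1)) K →ₐ[K] MvPolynomial (Fin n) K :=
  aeval (Fin.insertNth (α := fun _ => MvPolynomial (Fin n) K) p 0 X)

section

variable {K : Type*} [Field K] {n : ℕ}

theorem coeff_insertZero (p : Fin (n + 1)) (f : MvPolynomial (Fin (n + 1)) K) (m : Fin n →₀ ℕ) :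
    coeff m (insertZero K p f) = coeff (m.mapDomain p.succAbove) f := by
  induction f using MvPolynomial.induction_on' with
  | add f g hf hg => simp [hf, hg]
  | monomial c a =>
    have key : insertZero K p (monomial c a) =
        if c p = 0 then monomial (c.comapDomain p.succAbove
          (Fin.succAbove_right_injective.injOn)) a else 0 := by
      rw [insertZero, aeval_monomial, Finsupp.prod_fintype _ _ (by simp),
        Fin.prod_univ_succAbove _ p, algebraMap_eq]
      split_ifs with h
      · rw [h, pow_zero, one_mul, monomial_eq, Finsupp.prod_fintype _ _ (by simp)]
        simp
      · simp [h]
    rw [key, coeff_monomial]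
    have hval : ∀ j, (m.mapDomain p.succAbove) (p.succAbove j) = m j :=
      fun j => Finsupp.mapDomain_apply Fin.succAbove_right_injective _ _
    have hp : (m.mapDomain p.succAbove) p = 0 :=
      Finsupp.mapDomain_of_notMem_range _ _ (by simp)
    split_ifs with h1 h2 h2
    · rw [coeff_monomial, if_pos]
      subst h2
      ext j
      simp [hval]
    · rw [coeff_monomial, if_neg]
      rintro rfl
      apply h2
      ext i
      rcases Fin.eq_self_or_eq_succAbove p i with rfl | ⟨j, rfl⟩
      · rw [hp, h1]
      · rw [hval]; simp
    · exact absurd (h2 ▸ hp) h1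
    · simp

theorem mapDomain_succAbove_eq (k : Fin n) {m : Fin n →₀ ℕ} (hm : m k = 0) :
    m.mapDomain k.succ.succAbove = m.mapDomain k.castSucc.succAbove := by
  refine Finsupp.mapDomain_congr fun j hj => ?_
  have hjk : j ≠ k := by
    rintro rfl
    simp [hm] at hj
  ext
  simp only [Fin.succAbove, Fin.lt_def, Fin.val_castSucc, Fin.val_succ]
  have : (j : ℕ) ≠ k := fun h => hjk (Fin.ext h)
  split_ifs <;> simp <;> omega

/-- The quasisymmetric divided difference
`f ↦ (f(…, x_k, 0, …) - f(…, 0, x_k, …)) / x_k`. -/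
def trim (K : Type*) [Field K] {n : ℕ} (k : Fin n) :
    MvPolynomial (Fin (n + 1)) K →ₗ[K] MvPolynomial (Fin n) K where
  toFun f := (insertZero K k.succ f - insertZero K k.castSucc f).divMonomial (Finsupp.single k 1)
  map_add' f g := by
    rw [← add_divMonomial, map_add, map_add]
    congr 1
    ring
  map_smul' a f := by
    ext m
    simp [coeff_divMonomial, mul_sub]

theorem coeff_trim (k : Fin n) (f : MvPolynomial (Fin (n + 1)) K) (m : Fin n →₀ ℕ) :
    coeff m (trim K k f) =
      coeff ((Finsupp.single k 1 + m).mapDomain k.succ.succAbove) f -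
        coeff ((Finsupp.single k 1 + m).mapDomain k.castSucc.succAbove) f := by
  change coeff m (MvPolynomial.divMonomial (_ - _) _) = _
  rw [coeff_divMonomial, coeff_sub, coeff_insertZero, coeff_insertZero]

/-- The division in `trim` is exact: the slots k and k + 1 differ only in where they send x_k, so
monomials free of x_k cancel in the difference. -/
theorem X_mul_trim (k : Fin n) (f : MvPolynomial (Fin (n + 1)) K) :
    X k * trim K k f = insertZero K k.succ f - insertZero K k.castSucc f := by
  conv_rhs => rw [← divMonomial_add_modMonomial_single
    (insertZero K k.succ f - insertZero K k.castSucc f) k]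
  refine (add_eq_left.mpr ?_).symm
  ext m
  by_cases hm : m k = 0
  · rw [coeff_modMonomial_of_not_le, coeff_sub, coeff_insertZero, coeff_insertZero,
      mapDomain_succAbove_eq k hm, sub_self, coeff_zero]
    intro h
    have := h k
    simp [hm] at this
  · rw [coeff_modMonomial_of_le, coeff_zero]
    rw [Finsupp.single_le_iff]
    omega

theorem isHomogeneous_trim (k : Fin n) {f : MvPolynomial (Fin (n + 1)) K} {d : ℕ}
    (hf : f.IsHomogeneous (d + 1)) : (trim K k f).IsHomogeneous d := by
  intro m hm
  rw [coeff_trim] at hm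
  by_contra hd
  apply hm
  have hdeg : (Finsupp.single k 1 + m).degree ≠ d + 1 := by
    intro h
    apply hd
    rw [map_add, Finsupp.degree_single] at h
    change Finsupp.weight (fun _ => 1) m = d
    rw [← Finsupp.degree_eq_weight_one]
    omega
  rw [hf.coeff_eq_zero (by rwa [Finsupp.degree_mapDomain]), hf.coeff_eq_zero (by rwa [Finsupp.degree_mapDomain]),
    sub_self]

/-- The functional `f ↦ (∑ q^k T_k)^n f` on polynomials in `n + 1` variables, where the `T_k` are
the quasisymmetric divided differences. -/
def trimFunctional {K : Type*} [Field K] (q : K) : (n : ℕ) → MvPolynomial (Fin (n + 1)) K →ₗ[K] K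
  | 0 => lcoeff K 0
  | n + 1 => ∑ k : Fin (n + 1), q ^ (k : ℕ) • trimFunctional q n ∘ₗ trim K k

theorem trimFunctional_succ (q : K) (f : MvPolynomial (Fin (n + 2)) K) :
    trimFunctional q (n + 1) f =
      ∑ k : Fin (n + 1), q ^ (k : ℕ) * trimFunctional q n (trim K k f) := by
  simp [trimFunctional, LinearMap.sum_apply]

theorem exists_eq_sum_single (m : Fin n →₀ ℕ) :
    ∃ (k : ℕ) (_ : k ≤ n) (i : Fin k → Fin n) (α : Fin k → ℕ), StrictMono i ∧ (∀ j, 0 < α j) ∧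
      m = ∑ j, Finsupp.single (i j) (α j) := by
  refine ⟨#m.support, (card_le_univ _).trans (by simp), m.support.orderEmbOfFin rfl,
    fun j => m (m.support.orderEmbOfFin rfl j), (m.support.orderEmbOfFin rfl).strictMono, ?_, ?_⟩
  · intro j
    exact Nat.pos_of_ne_zero (Finsupp.mem_support_iff.mp (m.support.orderEmbOfFin_mem rfl j))
  · have h := Finset.sum_map univ (m.support.orderEmbOfFin rfl).toEmbedding
      (fun x => Finsupp.single x (m x))
    rw [Finset.map_orderEmbOfFin_univ] at h
    exact (Finsupp.sum_single m).symm.trans h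

/-- Both embeddings preserve the sequence of nonzero exponents, and a quasisymmetric coefficient
depends on nothing else. -/
theorem IsQuasisymmetric.coeff_mapDomain_eq {N : ℕ} {Q : MvPolynomial (Fin N) K}
    (hQ : IsQuasisymmetric Q) {e₁ e₂ : Fin n → Fin N} (he₁ : StrictMono e₁) (he₂ : StrictMono e₂)
    (m : Fin n →₀ ℕ) : coeff (m.mapDomain e₁) Q = coeff (m.mapDomain e₂) Q := by
  obtain ⟨k, hk, i, α, hi, hα, rfl⟩ := exists_eq_sum_single m
  have hnN : n ≤ N := by simpa using Fintype.card_le_of_injective _ he₁.injective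
  have h : ∀ e : Fin n → Fin N, StrictMono e →
      coeff ((∑ j, Finsupp.single (i j) (α j)).mapDomain e) Q =
        coeff (∑ j, Finsupp.single (Fin.castLE (hk.trans hnN) j) (α j)) Q := by
    intro e he
    rw [Finsupp.mapDomain_finsetSum]
    simp only [Finsupp.mapDomain_single]
    exact hQ k _ α hα (e ∘ i) (he.comp hi)
  rw [h _ he₁, h _ he₂]

theorem IsQuasisymmetric.insertZero_eq {Q : MvPolynomial (Fin (n + 1)) K}
    (hQ : IsQuasisymmetric Q) (p p' : Fin (n + 1)) : insertZero K p Q = insertZero K p' Q := by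
  ext m
  rw [coeff_insertZero, coeff_insertZero]
  exact hQ.coeff_mapDomain_eq (Fin.strictMono_succAbove _) (Fin.strictMono_succAbove _) m

theorem isQuasisymmetric_insertZero {Q : MvPolynomial (Fin (n + 1)) K}
    (hQ : IsQuasisymmetric Q) (p : Fin (n + 1)) : IsQuasisymmetric (insertZero K p Q) := by
  intro k hk α hα i hi
  rw [coeff_insertZero, coeff_insertZero]
  simp only [Finsupp.mapDomain_finsetSum, Finsupp.mapDomain_single]
  exact (hQ k (by omega) α hα _ ((Fin.strictMono_succAbove p).comp hi)).trans
    (hQ k (by omega) α hα _ ((Fin.strictMono_succAbove p).comp (Fin.strictMono_castLE hk))).symm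

/-- A quasisymmetric Q does not see where the zero is inserted, so it factors out of the difference.
-/
theorem trim_mul (k : Fin n) {Q : MvPolynomial (Fin (n + 1)) K} (hQ : IsQuasisymmetric Q)
    (f : MvPolynomial (Fin (n + 1)) K) :
    trim K k (f * Q) = trim K k f * insertZero K k.succ Q := by
  apply mul_left_cancel₀ (X_ne_zero (R := K) k)
  rw [← mul_assoc, X_mul_trim, X_mul_trim, map_mul, map_mul, hQ.insertZero_eq k.castSucc k.succ,
    sub_mul]

/-- Each step pulls out a factor that is again quasisymmetric without constant term; at the bottom
only the constant coefficient is read, and it vanishes. -/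
theorem trimFunctional_mul_quasisymmetric (q : K) :
    ∀ (n : ℕ) (f Q : MvPolynomial (Fin (n + 1)) K), IsQuasisymmetric Q → constantCoeff Q = 0 →
      trimFunctional q n (f * Q) = 0
  | 0, f, Q, _, h0 => by
    change coeff 0 (f * Q) = 0
    rw [← constantCoeff_eq, map_mul, h0, mul_zero]
  | n + 1, f, Q, hQ, h0 => by
    rw [trimFunctional_succ]
    refine sum_eq_zero fun k _ => ?_
    rw [trim_mul k hQ, trimFunctional_mul_quasisymmetric q n _ _ (isQuasisymmetric_insertZero hQ _), mul_zero]
    rw [constantCoeff_eq, coeff_insertZero, Finsupp.mapDomain_zero, ← constantCoeff_eq, h0]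

theorem trimFunctional_eq_zero (q : K) {h : MvPolynomial (Fin (n + 1)) K}
    (hh : h ∈ qsymPlus K (n + 1)) : trimFunctional q n h = 0 := by
  suffices H : ∀ f, trimFunctional q n (f * h) = 0 by simpa using H 1
  induction hh using Submodule.span_induction with
  | mem x hx => exact fun f => trimFunctional_mul_quasisymmetric q n f x hx.1 hx.2
  | zero => simp
  | add x y _ _ hx hy => intro f; rw [mul_add, map_add, hx, hy, add_zero]
  | smul a x _ ih => intro f; rw [smul_eq_mul, ← mul_assoc, ih]

end

/-! ### Evaluation on the span of ABB monomials -/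

section

variable {K : Type*} [Field K] {n : ℕ}

theorem eval_insertZero (y : Fin n → K) (p : Fin (n + 1)) (f : MvPolynomial (Fin (n + 1)) K) :
    eval y (insertZero K p f) = eval (Fin.insertNth (α := fun _ => K) p 0 y) f := by
  rw [insertZero, aeval_def, algebraMap_eq, eval_eval₂]
  have : (eval y).comp (C : K →+* MvPolynomial (Fin n) K) = RingHom.id K := by ext; simp
  rw [this, eval₂_id]
  refine congrArg (fun y' => eval y' f) (funext fun i => ?_)
  rcases Fin.eq_self_or_eq_succAbove p i with rfl | ⟨j, rfl⟩ <;> simp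

theorem abbSet_apply_last {c : Fin (n + 1) →₀ ℕ} (hc : c ∈ abbSet (n + 1)) :
    c (Fin.last n) = 0 := by
  have h := hc (Fin.last n)
  have h2 : c (Fin.last n) ≤ ∑ j ∈ Ici (Fin.last n), c j :=
    single_le_sum (f := fun j => c j) (fun _ _ => Nat.zero_le _) (by simp)
  simp only [Fin.val_last, Nat.sub_self] at h
  omega

theorem abbSet_apply_zero {c : Fin (n + 2) →₀ ℕ} (hc : c ∈ abbSet (n + 2))
    (hd : c.degree = n + 1) : c 0 ≠ 0 := by
  have h := hc 1
  have h2 := sum_extendZero_add c 1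
  rw [← Finsupp.degree_eq_sum] at h2
  simp [extendZero] at h h2
  omega

/-- This makes the ABB condition survive `trim`. For i ≤ k the tail from i contains the removed
unit, which pays for the bound dropping by one; for i > k the tail is compared with the one starting
at i + 1 upstairs, whose bound is already the smaller one. -/
theorem abbSet_of_mapDomain (k : Fin (n + 1)) (p : Fin (n + 2)) (hp : p = k.succ ∨ p = k.castSucc)
    {m : Fin (n + 1) →₀ ℕ}
    (hc : (Finsupp.single k 1 + m).mapDomain p.succAbove ∈ abbSet (n + 2)) :
    m ∈ abbSet (n + 1) := by
  intro i
  set m' := Finsupp.single k 1 + m with hm'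
  have hval : ∀ j, (m'.mapDomain p.succAbove) (p.succAbove j) = m' j :=
    fun j => Finsupp.mapDomain_apply Fin.succAbove_right_injective _ _
  have key : ∀ i' : Fin (n + 2), (∀ j, i ≤ j → i' ≤ p.succAbove j) →
      ∑ j ∈ Ici i, m' j ≤ n + 2 - (i' + 1) := by
    intro i' h
    refine le_trans ?_ (hc i')
    rw [sum_congr rfl fun j _ => (hval j).symm,
      ← sum_image (f := fun x => m'.mapDomain p.succAbove x)
        Fin.succAbove_right_injective.injOn]
    refine sum_le_sum_of_subset fun x hx => ?_
    obtain ⟨j, hj, rfl⟩ := mem_image.mp hx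
    exact mem_Ici.mpr (h j (mem_Ici.mp hj))
  have hpv : (p : ℕ) = k + 1 ∨ (p : ℕ) = k := by rcases hp with rfl | rfl <;> simp
  have hsplit : ∑ j ∈ Ici i, m' j = (if i ≤ k then 1 else 0) + ∑ j ∈ Ici i, m j := by
    simp [hm', sum_add_distrib, Finsupp.single_apply]
  rw [hsplit] at key
  by_cases hik : i ≤ k
  · have := key i.castSucc fun j hj => by
      simp only [Fin.le_def, Fin.succAbove, Fin.lt_def, Fin.val_castSucc] at *
      split_ifs <;> simp <;> omega
    simp [hik] at this
    omega
  · have := key i.succ fun j hj => by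
      simp only [Fin.le_def, Fin.succAbove, Fin.lt_def, Fin.val_castSucc, Fin.val_succ] at *
      split_ifs <;> simp <;> omega
    simp [hik] at this
    omega

/-- By induction the k-th term is the value of R_{k+1} f - R_k f, because q^k is the value of x_k.
The telescoped sum leaves R_{n+1} f - R_0 f: the first has the value of f since the last exponent is
0, and the second vanishes since the first exponent is positive in top degree. -/
theorem trimFunctional_eq_eval (q : K) :
    ∀ (n : ℕ) (f : MvPolynomial (Fin (n + 1)) K),
      (∀ c, coeff c f ≠ 0 → c ∈ abbSet (n + 1) ∧ c.degree = n) →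
      trimFunctional q n f = eval (fun i : Fin (n + 1) => q ^ (i : ℕ)) f
  | 0, f, hf => by
    have : f = C (coeff 0 f) := by
      ext c
      rw [coeff_C]
      split_ifs with h
      · rw [h]
      · by_contra h0
        exact h ((Finsupp.degree_eq_zero_iff c).mp (hf c h0).2).symm
    rw [this, eval_C]
    change coeff 0 (C _) = _
    simp
  | n + 1, f, hf => by
    have hterm : ∀ k : Fin (n + 1), q ^ (k : ℕ) * trimFunctional q n (trim K k f) =
        eval (fun i : Fin (n + 1) => q ^ (i : ℕ)) (insertZero K k.succ f) -
          eval (fun i : Fin (n + 1) => q ^ (i : ℕ)) (insertZero K k.castSucc f) := by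
      intro k
      rw [trimFunctional_eq_eval q n, ← map_sub, ← X_mul_trim, map_mul, eval_X]
      intro m hm
      rw [coeff_trim] at hm
      have : ∃ p : Fin (n + 2), (p = k.succ ∨ p = k.castSucc) ∧
          coeff ((Finsupp.single k 1 + m).mapDomain p.succAbove) f ≠ 0 := by
        by_contra! h
        exact hm (by rw [h _ (Or.inl rfl), h _ (Or.inr rfl), sub_zero])
      obtain ⟨p, hp, h⟩ := this
      obtain ⟨h1, h2⟩ := hf _ h
      refine ⟨abbSet_of_mapDomain k p hp h1, ?_⟩
      rw [Finsupp.degree_mapDomain, map_add, Finsupp.degree_single] at h2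
      omega
    have htel := Fin.sum_univ_castSucc (n := n + 1) fun p =>
      eval (fun i : Fin (n + 1) => q ^ (i : ℕ)) (insertZero K p f)
    rw [Fin.sum_univ_succ] at htel
    rw [trimFunctional_succ, sum_congr rfl fun k _ => hterm k, sum_sub_distrib]
    have hlast : eval (fun i : Fin (n + 1) => q ^ (i : ℕ)) (insertZero K (Fin.last _) f) =
        eval (fun i : Fin (n + 2) => q ^ (i : ℕ)) f := by
      rw [eval_insertZero, eval_eq', eval_eq']
      refine sum_congr rfl fun c hc => ?_
      have h0 := abbSet_apply_last (hf c (mem_support_iff.mp hc)).1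
      rw [Fin.prod_univ_castSucc]
      conv_rhs => rw [Fin.prod_univ_castSucc]
      rw [h0]
      simp
    have hzero : eval (fun i : Fin (n + 1) => q ^ (i : ℕ)) (insertZero K 0 f) = 0 := by
      rw [eval_insertZero, eval_eq']
      refine sum_eq_zero fun c hc => ?_
      have h0 := hf c (mem_support_iff.mp hc)
      rw [Fin.prod_univ_succ]
      simp [abbSet_apply_zero h0.1 h0.2]
    rw [hlast, hzero] at htel
    linear_combination htel

theorem IsQuasisymmetric.homogeneousComponent {Q : MvPolynomial (Fin n) K}
    (hQ : IsQuasisymmetric Q) (d : ℕ) :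
    IsQuasisymmetric (MvPolynomial.homogeneousComponent d Q) := by
  intro k hk α hα i hi
  have hdeg : ∀ e : Fin k → Fin n, (∑ j, Finsupp.single (e j) (α j)).degree = ∑ j, α j := by
    intro e
    simp [map_sum]
  rw [coeff_homogeneousComponent, coeff_homogeneousComponent, hdeg, hdeg, hQ k hk α hα i hi]

/-- Homogeneous components of quasisymmetric polynomials are quasisymmetric, so the ideal has
homogeneous generators. -/
theorem homogeneousComponent_mem_qsymPlus {h : MvPolynomial (Fin n) K} (hh : h ∈ qsymPlus K n)
    (d : ℕ) : homogeneousComponent d h ∈ qsymPlus K n := by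
  set s : Set (MvPolynomial (Fin n) K) :=
    {p | (IsQuasisymmetric p ∧ constantCoeff p = 0) ∧ ∃ d, p.IsHomogeneous d} with hs
  have hle : Ideal.span s ≤ qsymPlus K n := Ideal.span_mono fun p hp => hp.1
  have hge : qsymPlus K n ≤ Ideal.span s := by
    refine Ideal.span_le.mpr fun p hp => ?_
    rw [SetLike.mem_coe, ← sum_homogeneousComponent p]
    refine Ideal.sum_mem _ fun e _ => Ideal.subset_span ⟨⟨hp.1.homogeneousComponent e, ?_⟩, e,
      homogeneousComponent_isHomogeneous e p⟩
    rw [constantCoeff_eq, coeff_homogeneousComponent, ← constantCoeff_eq, hp.2, ite_self]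
  let _ := gradedAlgebra (σ := Fin n) (R := K)
  have hhom : (Ideal.span s).IsHomogeneous (homogeneousSubmodule (Fin n) K) :=
    Ideal.homogeneous_span _ _ fun p hp => hp.2
  exact hle ((mem_iff_homogeneousComponent_mem hhom h).mp (hge hh) d)

theorem coeff_ne_zero_of_mem_abbSpan {g : MvPolynomial (Fin n) K} (hg : g ∈ abbSpan K n)
    {c : Fin n →₀ ℕ} (hc : coeff c g ≠ 0) : c ∈ abbSet n := by
  have : g ∈ restrictSupport K (abbSet n) := by rwa [restrictSupport_eq_span]
  exact (mem_restrictSupport_iff K).mp this (mem_support_iff.mpr hc)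

theorem degree_le_of_mem_abbSet {c : Fin (n + 1) →₀ ℕ} (hc : c ∈ abbSet (n + 1)) :
    c.degree ≤ n := by
  have h := hc 0
  have h2 := sum_extendZero_add c 0
  rw [← Finsupp.degree_eq_sum] at h2
  simp at h h2
  omega

/-- The exponent of x_0 enters only the tail sum from 0, which is the total degree. -/
theorem single_zero_add_mem_abbSet {c : Fin (n + 1) →₀ ℕ} (hc : c ∈ abbSet (n + 1)) {r : ℕ}
    (hr : r + c.degree ≤ n) : Finsupp.single 0 r + c ∈ abbSet (n + 1) := by
  intro i
  rcases eq_or_ne i 0 with rfl | hi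
  · refine (sum_le_univ_sum_of_nonneg fun _ => Nat.zero_le _).trans ?_
    rw [← Finsupp.degree_eq_sum, map_add, Finsupp.degree_single]
    simpa using hr
  · refine le_of_eq_of_le (sum_congr rfl fun j hj => ?_) (hc i)
    have : j ≠ 0 := by
      rintro rfl
      exact hi (Fin.le_zero_iff.mp (mem_Ici.mp hj))
    simp [this.symm]

/-- Although f is homogeneous, g need not be, so its components of degree below n must be shown to
vanish at the point. Such a component is minus that of h, hence lies in the ideal. -/
theorem trimFunctional_eq_eval_of_eq_add (q : K) {f g h : MvPolynomial (Fin (n + 1)) K}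
    (hf : f.IsHomogeneous n) (hg : g ∈ abbSpan K (n + 1)) (hh : h ∈ qsymPlus K (n + 1))
    (hfgh : f = g + h) :
    trimFunctional q n f = eval (fun i : Fin (n + 1) => q ^ (i : ℕ)) g := by
  -- Multiplying by x_0^(n-d) raises the degree to n, keeps the support in the ABB set, and does not
  -- change the value because x_0 evaluates to q^0 = 1.
  have hsupp : ∀ d ≤ n, trimFunctional q n (X 0 ^ (n - d) * homogeneousComponent d g) =
      eval (fun i : Fin (n + 1) => q ^ (i : ℕ)) (homogeneousComponent d g) := by
    intro d hd
    rw [trimFunctional_eq_eval, map_mul, map_pow, eval_X]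
    · simp
    · intro c hc
      rw [X_pow_eq_monomial, coeff_monomial_mul', one_mul] at hc
      split_ifs at hc with hle
      · rw [coeff_homogeneousComponent] at hc
        split_ifs at hc with hdeg
        · have hcabb := coeff_ne_zero_of_mem_abbSpan hg hc
          rw [← add_tsub_cancel_of_le hle]
          refine ⟨single_zero_add_mem_abbSet hcabb (by omega), ?_⟩
          rw [map_add, Finsupp.degree_single]
          omega
        · exact absurd rfl hc
      · exact absurd rfl hc
  have hlow : ∀ d < n,
      eval (fun i : Fin (n + 1) => q ^ (i : ℕ)) (homogeneousComponent d g) = 0 := by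
    intro d hd
    rw [← hsupp d hd.le]
    have : homogeneousComponent d g = - homogeneousComponent d h := by
      have h0 := homogeneousComponent_of_mem (m := d) hf
      rw [if_neg hd.ne, hfgh, map_add] at h0
      exact eq_neg_of_add_eq_zero_left h0
    rw [this]
    exact trimFunctional_eq_zero q (Ideal.mul_mem_left _ _
      (neg_mem (homogeneousComponent_mem_qsymPlus hh d)))
  have htop : trimFunctional q n f =
      eval (fun i : Fin (n + 1) => q ^ (i : ℕ)) (homogeneousComponent n g) := by
    have h0 := homogeneousComponent_of_mem (m := n) hf
    rw [if_pos rfl] at h0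
    rw [← h0, hfgh, map_add, map_add,
      trimFunctional_eq_zero q (homogeneousComponent_mem_qsymPlus hh n), add_zero, ← hsupp n le_rfl]
    simp
  have hdeg : g.totalDegree ≤ n := by
    refine Finset.sup_le fun c hc => ?_
    exact degree_le_of_mem_abbSet (coeff_ne_zero_of_mem_abbSpan hg (mem_support_iff.mp hc))
  rw [htop]
  conv_rhs => rw [← sum_homogeneousComponent g, map_sum]
  rw [sum_subset (range_subset_range.mpr (by omega : g.totalDegree + 1 ≤ n + 1)),
    sum_range_succ, sum_eq_zero fun d hd => hlow d (mem_range.mp hd), zero_add]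
  intro d _ hd
  rw [homogeneousComponent_eq_zero _ _ (by simpa using hd), map_zero]

end

/-! ### Coarea of the Dyck path -/

section

theorem stepWord_isPrefix (d : ℕ → ℕ) {a m : ℕ} (h : a ≤ m) : stepWord d a <+: stepWord d m := by
  induction m, h using Nat.le_induction with
  | base => exact List.prefix_rfl
  | succ m _ ih =>
    rw [stepWord_succ]
    exact ih.trans (List.prefix_append _ _)

theorem count_D_take_stepWord_le (d : ℕ → ℕ) {a m p : ℕ} (h : a < m)
    (hp : p < (stepWord d (a + 1)).length) :
    ((stepWord d m).take p).count DyckStep.D ≤ a := by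
  obtain ⟨t, ht⟩ := stepWord_isPrefix d (Nat.succ_le_of_lt h)
  rw [← ht, List.take_append_of_le_length hp.le, stepWord_succ, ← List.append_assoc]
  rw [stepWord_succ, ← List.append_assoc, List.length_append, List.length_singleton] at hp
  rw [List.take_append_of_le_length (by omega)]
  refine ((List.take_sublist _ _).count_le _).trans ?_
  simp [stepWord_count_D, List.count_replicate]

/-- The path first reaches abscissa a + 1 at the end of block a, and north steps only accumulate
afterwards, so that point is the optimal witness. -/
theorem exists_take_stepWord_iff (d : ℕ → ℕ) {a b m : ℕ} (h : a < m) :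
    (∃ p ∈ range ((stepWord d m).length + 1),
      a + 1 ≤ ((stepWord d m).take p).count DyckStep.D ∧
        ((stepWord d m).take p).count DyckStep.U ≤ b) ↔ ∑ i ∈ range (a + 1), d i ≤ b := by
  have hpre := stepWord_isPrefix d (Nat.succ_le_of_lt h)
  have htake : (stepWord d m).take (stepWord d (a + 1)).length = stepWord d (a + 1) :=
    (List.prefix_iff_eq_take.mp hpre).symm
  constructor
  · rintro ⟨p, -, hD, hU⟩
    have hp : (stepWord d (a + 1)).length ≤ p := by
      by_contra hp
      have := count_D_take_stepWord_le d h (not_le.mp hp)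
      omega
    refine le_trans ?_ hU
    rw [← stepWord_count_U, ← htake]
    exact ((List.take_prefix_take_left hp).sublist.count_le _)
  · intro hb
    refine ⟨(stepWord d (a + 1)).length, mem_range.mpr (Nat.lt_succ_of_le hpre.length_le), ?_⟩
    rw [htake, stepWord_count_D, stepWord_count_U]
    exact ⟨le_rfl, hb⟩

/-- Column a has m - (d_0 + ⋯ + d_a) = ∑_{i>a} d_i cells above the path, where m = n - 1; exchanging
the sums counts each d_i once for every a < i. -/
theorem coarea_abbDyck {n : ℕ} (c : Fin n →₀ ℕ) (hc : c ∈ abbSet n) (hdeg : ∑ i, c i = n - 1) :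
    coarea (abbDyck c hc hdeg) = ∑ i ∈ range (n - 1), i * extendZero c i := by
  set d := extendZero c with hd
  have htot := abbSet_total hc hdeg
  have hpre : ∀ j ≤ n - 1, j ≤ ∑ i ∈ range j, d i := fun j hj => abbSet_prefix hc hdeg hj
  rw [← hd] at htot
  have hlist : (abbDyck c hc hdeg).toList = stepWord d (n - 1) := rfl
  have hsemi : (abbDyck c hc hdeg).semilength = n - 1 := by
    rw [DyckWord.semilength, hlist, stepWord_count_U, htot]
  rw [coarea, hsemi, hlist, card_eq_sum_ones, sum_filter, sum_product]
  clear hsemi hlist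
  clear hdeg
  generalize n - 1 = m at htot hpre ⊢
  trans ∑ a ∈ range m, ∑ i ∈ range m, if a < i then d i else 0
  · refine sum_congr rfl fun a ha => ?_
    rw [mem_range] at ha
    simp only [exists_take_stepWord_iff d ha]
    rw [← sum_filter, ← card_eq_sum_ones, ← sum_filter]
    -- The condition a < b is automatic: the path lies weakly above the diagonal, so the partial sum
    -- is at least a + 1.
    have h1 : {b ∈ range m | a < b ∧ ∑ i ∈ range (a + 1), d i ≤ b} =
        Ico (∑ i ∈ range (a + 1), d i) m := by
      ext b
      have := hpre (a + 1) ha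
      simp only [mem_filter, mem_range, mem_Ico]
      omega
    have h2 : {i ∈ range m | a < i} = Ico (a + 1) m := by
      ext i
      simp only [mem_filter, mem_range, mem_Ico]
      omega
    have h3 := sum_range_add_sum_Ico d (Nat.succ_le_of_lt ha)
    rw [h1, h2, Nat.card_Ico]
    simp only [Nat.succ_eq_add_one] at h3
    omega
  rw [sum_comm]
  refine sum_congr rfl fun i hi => ?_
  rw [mem_range] at hi
  rw [← sum_filter, sum_const, smul_eq_mul]
  congr 1
  have : {a ∈ range m | a < i} = range i := by
    ext a
    simp only [mem_filter, mem_range]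
    omega
  rw [this, card_range]

theorem eval_monomial_eq_pow_coarea {K : Type*} [Field K] (q : K) {n : ℕ} (c : Fin n →₀ ℕ)
    (hc : c ∈ abbSet n) (hdeg : ∑ i, c i = n - 1) :
    eval (fun i : Fin n => q ^ (i : ℕ)) (monomial c 1) = q ^ coarea (abbDyck c hc hdeg) := by
  rw [coarea_abbDyck, eval_monomial, one_mul, Finsupp.prod_fintype _ _ (by simp)]
  obtain _ | n := n
  · simp
  rw [Fin.prod_univ_castSucc, abbSet_apply_last hc, pow_zero, mul_one, Nat.add_sub_cancel,
    Finset.sum_range, ← prod_pow_eq_pow_sum]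
  refine prod_congr rfl fun i _ => ?_
  rw [← pow_mul, extendZero, dif_pos (by omega)]
  rfl

end

/-! ### Alternating sums with one variable set to zero -/

section

variable {A : Type*} [CommRing A] {n : ℕ}

/-- The alternating sum `∑ sgn(σ) F(x_{σ(1)}, …, x_{σ(n)})`. -/
def altSum (F : (Fin n → A) → A) (x : Fin n → A) : A :=
  ∑ σ : Equiv.Perm (Fin n), ((Equiv.Perm.sign σ : ℤ) : A) * F (x ∘ σ)

/-- The product of the `q xᵢ - xⱼ` over `i < j` with `j ≠ i + 1`. -/
def gapProd (q : A) (x : Fin n → A) : A :=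
  ∏ i : Fin n, ∏ j : Fin n, if (i : ℕ) + 1 < j then q * x i - x j else 1

/-- Every permutation factors uniquely as one fixing 0 after the cycle that brings position p to 0,
where p is the position receiving the zero; the cycle has sign (-1)^p. -/
theorem altSum_cons_zero (F : (Fin (n + 1) → A) → A) (y : Fin n → A) :
    altSum F (Fin.cons 0 y) = ∑ p : Fin (n + 1), (-1) ^ (p : ℕ) *
      altSum (fun z => F (Fin.insertNth (α := fun _ => A) p 0 z)) y := by
  set φ : Fin (n + 1) × Equiv.Perm (Fin n) → Equiv.Perm (Fin (n + 1)) :=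
    fun pe => Equiv.Perm.decomposeFin.symm (0, pe.2) * pe.1.cycleRange with hφ
  have hinj : Function.Injective φ := by
    rintro ⟨p, e⟩ ⟨p', e'⟩ h
    have hp : p = p' := by
      have h1 : φ (p, e) p = 0 := by simp [hφ, Equiv.Perm.decomposeFin_symm_apply_zero]
      have h2 : φ (p', e') p' = 0 := by simp [hφ, Equiv.Perm.decomposeFin_symm_apply_zero]
      rw [← h] at h2
      exact (φ (p, e)).injective (h1.trans h2.symm)
    subst hp
    have := mul_right_cancel h
    simpa using this
  have hbij : Function.Bijective φ := by
    rw [Fintype.bijective_iff_injective_and_card]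
    refine ⟨hinj, ?_⟩
    simp [Fintype.card_perm, Nat.factorial_succ]
  rw [altSum, ← (Equiv.ofBijective φ hbij).sum_comp, Fintype.sum_prod_type]
  refine sum_congr rfl fun p _ => ?_
  rw [altSum, mul_sum]
  refine sum_congr rfl fun e _ => ?_
  have hcomp : (Fin.cons 0 y : Fin (n + 1) → A) ∘ φ (p, e) =
      Fin.insertNth (α := fun _ => A) p 0 (y ∘ e) := by
    rw [← Fin.cons_comp_cycleRange]
    ext i
    simp only [hφ, Function.comp_apply, Equiv.Perm.mul_apply]
    generalize p.cycleRange i = j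
    refine Fin.cases ?_ (fun j => ?_) j <;> simp
  rw [Equiv.ofBijective_apply, hcomp]
  simp [hφ, Fin.sign_cycleRange]
  ring

/-- The product of all `x j` with `j ≠ k`. -/
def prodOmit (x : Fin n → A) (k : Fin n) : A :=
  (∏ j ∈ Iio k, x j) * ∏ j ∈ Ioi k, x j

theorem mul_prodOmit (x : Fin n → A) (k : Fin n) : x k * prodOmit x k = ∏ j, x j := by
  have h : (univ : Finset (Fin n)) = insert k (Iio k ∪ Ioi k) := by
    ext j
    simp only [mem_univ, mem_insert, mem_union, mem_Iio, mem_Ioi, true_iff]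
    rcases lt_trichotomy j k with h | h | h <;> simp [h]
  rw [h, prod_insert (by simp), prod_union, prodOmit]
  rw [disjoint_left]
  intro j hj hj'
  rw [mem_Iio] at hj
  rw [mem_Ioi] at hj'
  exact absurd hj (not_lt.mpr hj'.le)

/-- The factor by which `gapProd` changes when `0` is inserted at position `p`. -/
def insertFactor (q : A) (p : Fin (n + 1)) (z : Fin n → A) : A :=
  (∏ j : Fin n, if (p : ℕ) < j then -z j else 1) *
    (∏ i : Fin n, if (i : ℕ) + 1 < p then q * z i else 1) *
    ∏ i : Fin n, ∏ j : Fin n, if (i : ℕ) + 1 = j ∧ (j : ℕ) = p then q * z i - z j else 1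

/-- The new zero forms pairs with non-neighbours on its right (-z_j) and on its left (q z_i). It
also separates the old neighbours p - 1 and p, whose pair now counts as a gap. -/
theorem gapProd_insertNth (q : A) (p : Fin (n + 1)) (z : Fin n → A) :
    gapProd q (Fin.insertNth (α := fun _ => A) p 0 z) = gapProd q z * insertFactor q p z := by
  rw [gapProd, Fin.prod_univ_succAbove _ p, Fin.prod_univ_succAbove _ p]
  simp only [Fin.prod_univ_succAbove _ p, Fin.insertNth_apply_same, Fin.insertNth_apply_succAbove]
  rw [prod_mul_distrib, if_neg (by omega), one_mul, mul_zero]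
  have h1 : ∀ j : Fin n, (if (p : ℕ) + 1 < p.succAbove j then 0 - z j else 1) =
      if (p : ℕ) < j then -z j else 1 := by
    intro j
    rw [zero_sub]
    refine if_congr ?_ rfl rfl
    simp only [Fin.succAbove, Fin.lt_def, Fin.val_castSucc]
    split_ifs <;> simp
    omega
  have h2 : ∀ i : Fin n, (if (p.succAbove i : ℕ) + 1 < p then q * z i - 0 else 1) =
      if (i : ℕ) + 1 < p then q * z i else 1 := by
    intro i
    rw [sub_zero]
    refine if_congr ?_ rfl rfl
    simp only [Fin.succAbove, Fin.lt_def, Fin.val_castSucc]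
    split_ifs <;> simp
    omega
  have h3 : ∀ i j : Fin n,
      (if (p.succAbove i : ℕ) + 1 < p.succAbove j then q * z i - z j else 1) =
      (if (i : ℕ) + 1 < j then q * z i - z j else 1) *
        if (i : ℕ) + 1 = j ∧ (j : ℕ) = p then q * z i - z j else 1 := by
    intro i j
    have : (p.succAbove i : ℕ) + 1 < p.succAbove j ↔
        (i : ℕ) + 1 < j ∨ ((i : ℕ) + 1 = j ∧ (j : ℕ) = p) := by
      simp only [Fin.succAbove, Fin.lt_def, Fin.val_castSucc]
      split_ifs <;> simp <;> omega
    simp only [this]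
    by_cases ha : (i : ℕ) + 1 < j
    · rw [if_pos (Or.inl ha), if_pos ha, if_neg (by omega), mul_one]
    · simp [ha]
  simp only [h1, h2, h3, prod_mul_distrib]
  rw [gapProd, insertFactor]
  ring

theorem insertFactor_zero (q : A) (z : Fin (n + 1) → A) :
    insertFactor q 0 z = (-1) ^ n * prodOmit z 0 := by
  have h1 : ∏ j : Fin (n + 1), (if ((0 : Fin (n + 2)) : ℕ) < j then -z j else 1) =
      ∏ j ∈ Ioi 0, -z j := by
    rw [← prod_filter]
    refine prod_congr (Finset.ext fun j => ?_) fun _ _ => rfl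
    rw [mem_filter_univ, mem_Ioi, Fin.lt_def, Fin.val_zero, Fin.val_zero]
  have h2 : ∏ i : Fin (n + 1), (if (i : ℕ) + 1 < (0 : Fin (n + 2)) then q * z i else 1) = 1 :=
    prod_eq_one fun i _ => if_neg (by rw [Fin.val_zero]; omega)
  have h3 : ∏ i : Fin (n + 1), ∏ j : Fin (n + 1),
      (if (i : ℕ) + 1 = j ∧ (j : ℕ) = (0 : Fin (n + 2)) then q * z i - z j else 1) = 1 :=
    prod_eq_one fun i _ => prod_eq_one fun j _ => if_neg (by rw [Fin.val_zero]; omega)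
  have h4 : Iio (0 : Fin (n + 1)) = ∅ := by ext; simp
  rw [insertFactor, h1, h2, h3, prod_neg, prodOmit, h4, prod_empty, Fin.card_Ioi]
  simp

theorem insertFactor_last (q : A) (z : Fin (n + 1) → A) :
    insertFactor q (Fin.last (n + 1)) z = q ^ n * prodOmit z (Fin.last n) := by
  have h1 : ∏ j : Fin (n + 1), (if (Fin.last (n + 1) : ℕ) < j then -z j else 1) = 1 :=
    prod_eq_one fun i _ => if_neg (by rw [Fin.val_last]; omega)
  have h2 : ∏ i : Fin (n + 1), (if (i : ℕ) + 1 < Fin.last (n + 1) then q * z i else 1) =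
      ∏ i ∈ Iio (Fin.last n), q * z i := by
    rw [← prod_filter]
    refine prod_congr (Finset.ext fun j => ?_) fun _ _ => rfl
    rw [mem_filter_univ, mem_Iio, Fin.lt_def, Fin.val_last, Fin.val_last, Nat.add_lt_add_iff_right]
  have h3 : ∏ i : Fin (n + 1), ∏ j : Fin (n + 1),
      (if (i : ℕ) + 1 = j ∧ (j : ℕ) = Fin.last (n + 1) then q * z i - z j else 1) = 1 :=
    prod_eq_one fun i _ => prod_eq_one fun j _ => if_neg (by rw [Fin.val_last]; omega)
  have h4 : Ioi (Fin.last n) = ∅ := by ext; simp [Fin.le_last]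
  rw [insertFactor, h1, h2, h3, prod_mul_distrib, prod_const, prodOmit, h4, prod_empty,
    Fin.card_Iio, Fin.val_last]
  ring

/-- Expanding the factor q z_k - z_{k+1} of the separated neighbours gives two products, each
omitting one variable. This difference is what allows summation by parts. -/
theorem insertFactor_succ_castSucc (q : A) (z : Fin (n + 1) → A) (k : Fin n) :
    (-1) ^ (k : ℕ) * insertFactor q k.castSucc.succ z =
      (-1) ^ n * (q ^ (k : ℕ) * prodOmit z k.castSucc - q ^ (k + 1 : ℕ) * prodOmit z k.succ) := by
  have h1 : ∏ j : Fin (n + 1), (if (k.castSucc.succ : ℕ) < j then -z j else 1) =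
      ∏ j ∈ Ioi k.succ, -z j := by
    rw [← prod_filter]
    congr 1
    ext j
    simp [Fin.lt_def]
  have h2 : ∏ i : Fin (n + 1), (if (i : ℕ) + 1 < k.castSucc.succ then q * z i else 1) =
      ∏ i ∈ Iio k.castSucc, q * z i := by
    rw [← prod_filter]
    congr 1
    ext j
    simp [Fin.lt_def]
  have h3 : (∏ i : Fin (n + 1), ∏ j : Fin (n + 1),
      if (i : ℕ) + 1 = j ∧ (j : ℕ) = k.castSucc.succ then q * z i - z j else 1) =
      q * z k.castSucc - z k.succ := by
    rw [prod_eq_single k.castSucc, prod_eq_single k.succ]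
    · simp
    · intro j _ hj
      rw [if_neg]
      rintro ⟨-, h⟩
      exact hj (Fin.ext (by simpa using h))
    · simp
    · intro i _ hi
      refine prod_eq_one fun j _ => if_neg ?_
      rintro ⟨h, h'⟩
      refine hi (Fin.ext ?_)
      simp only [Fin.val_succ, Fin.val_castSucc] at h' ⊢
      omega
    · simp
  have h4 : Iio k.succ = insert k.castSucc (Iio k.castSucc) := by
    ext j
    simp only [mem_Iio, mem_insert, Fin.lt_def, Fin.ext_iff, Fin.val_succ, Fin.val_castSucc]
    omega
  have h5 : Ioi k.castSucc = insert k.succ (Ioi k.succ) := by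
    ext j
    simp only [mem_Ioi, mem_insert, Fin.lt_def, Fin.ext_iff, Fin.val_succ, Fin.val_castSucc]
    omega
  -- There are n - 1 - k variables to the right of z_{k+1}; the last sign reverses the difference.
  have hs : (-1 : A) ^ n = (-1) ^ (k : ℕ) * (-1) ^ (n - 1 - k) * (-1) := by
    rw [← pow_add, ← pow_succ]
    congr 1
    omega
  rw [insertFactor, h1, h2, h3, prod_neg, prod_mul_distrib, prod_const, prodOmit, prodOmit, h4, h5,
    prod_insert (by simp), prod_insert (by simp), hs, Fin.card_Ioi, Fin.card_Iio]
  have hk : n + 1 - 1 - (k.succ : ℕ) = n - 1 - k := by simp only [Fin.val_succ]; omega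
  rw [hk, Fin.val_castSucc]
  ring

/-- Summation by parts. Up to a global sign, the coefficient of F p is a_{p-1} - a_p with a_k = q^k
· `prodOmit z k`; the zeros in `Fin.cons` and `Fin.snoc` are the boundary terms. -/
theorem sum_insertFactor (q : A) (z : Fin (n + 1) → A) (F : Fin (n + 2) → A) :
    ∑ p : Fin (n + 2), (-1) ^ (p : ℕ) * (insertFactor q p z * F p) =
      (-1) ^ (n + 1) *
        ∑ k : Fin (n + 1), q ^ (k : ℕ) * prodOmit z k * (F k.succ - F k.castSucc) := by
  have hsplit : ∀ p : Fin (n + 2), (-1) ^ (p : ℕ) * insertFactor q p z = (-1) ^ (n + 1) *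
      (Fin.cons (α := fun _ => A) 0 (fun k => q ^ (k : ℕ) * prodOmit z k) p -
        Fin.snoc (α := fun _ => A) (fun k => q ^ (k : ℕ) * prodOmit z k) 0 p) := by
    intro p
    refine Fin.cases ?_ (fun k => ?_) p
    · have : (0 : Fin (n + 2)) = (0 : Fin (n + 1)).castSucc := rfl
      rw [insertFactor_zero, Fin.cons_zero, this, Fin.snoc_castSucc]
      simp [pow_succ]
    · rw [Fin.cons_succ]
      refine Fin.lastCases ?_ (fun k => ?_) k
      · rw [Fin.succ_last, insertFactor_last, Fin.snoc_last]
        simp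
      · rw [Fin.succ_castSucc, Fin.snoc_castSucc, ← Fin.succ_castSucc]
        have := insertFactor_succ_castSucc q z k
        simp only [Fin.val_succ, Fin.val_castSucc] at this ⊢
        rw [pow_succ, mul_right_comm, this]
        ring
  simp_rw [← mul_assoc, hsplit, mul_assoc]
  rw [← mul_sum]
  congr 1
  simp_rw [sub_mul, sum_sub_distrib]
  rw [Fin.sum_univ_succ, Fin.sum_univ_castSucc (n := n + 1)]
  simp [mul_sub, sum_sub_distrib, mul_assoc]

end

/-! ### Comparison with the Vandermonde product -/

section

variable {K : Type*} [Field K] {n : ℕ}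

/-- The product `∏_{i<j} (xᵢ - xⱼ)`. -/
def diffProd {A : Type*} [CommRing A] (x : Fin n → A) : A :=
  ∏ i : Fin n, ∏ j ∈ Ioi i, (x i - x j)

/-- The k-th smallest of n distinct naturals is at least k, so the minimal sum forces the values 0,
…, n - 1. -/
theorem lt_of_injective_of_sum_eq {c : Fin n → ℕ} (hinj : Function.Injective c)
    (hsum : ∑ i, c i = ∑ i ∈ range n, i) (i : Fin n) : c i < n := by
  set s := univ.image c with hs
  have hcard : #s = n := by rw [hs, card_image_of_injective _ hinj, card_univ, Fintype.card_fin]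
  set e := s.orderEmbOfFin hcard with he
  have hle : ∀ k : Fin n, (k : ℕ) ≤ e k := by
    rintro ⟨k, hk⟩
    induction k with
    | zero => exact Nat.zero_le _
    | succ k ih =>
      have h1 := ih (by omega)
      have h2 : e ⟨k, by omega⟩ < e ⟨k + 1, hk⟩ := e.strictMono (by simp [Fin.lt_def])
      simp only at h1 ⊢
      omega
  have hsum' : ∑ k : Fin n, (k : ℕ) = ∑ k, e k := by
    have h := Finset.sum_map univ e.toEmbedding (fun x => x)
    rw [he, Finset.map_orderEmbOfFin_univ] at h
    rw [← he] at h
    replace h := (sum_image (f := fun x => x) hinj.injOn).symm.trans h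
    rw [hsum] at h
    rw [← Finset.sum_range (fun k => k)]
    exact h
  have heq := (sum_eq_sum_iff_of_le fun k _ => hle k).mp hsum'
  have hmem : c i ∈ s := mem_image_of_mem c (mem_univ i)
  rw [← Finset.map_orderEmbOfFin_univ s hcard, mem_map] at hmem
  obtain ⟨k, -, hk⟩ := hmem
  rw [← hk]
  exact (heq k (mem_univ k)).symm.trans_lt k.2

/-- The alternating sum is a determinant of powers. In this degree, either two exponents coincide
and it is zero, or the exponents permute 0, …, n - 1 and it is a Vandermonde determinant up to sign.
-/
theorem exists_altSum_pow_eq {A : Type*} [CommRing A] {c : Fin n → ℕ}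
    (hsum : ∑ i, c i = ∑ i ∈ range n, i) :
    ∃ ε : ℤ, ∀ x : Fin n → A, altSum (fun x => ∏ i, x i ^ c i) x = ε * diffProd x := by
  have hdet : ∀ x : Fin n → A, altSum (fun x => ∏ i, x i ^ c i) x =
      Matrix.det (Matrix.of fun i j => x i ^ c j) := by
    intro x
    rw [Matrix.det_apply']
    rfl
  by_cases hinj : Function.Injective c
  · let τ : Equiv.Perm (Fin n) := Equiv.ofBijective
      (fun i => ⟨c i, lt_of_injective_of_sum_eq hinj hsum i⟩)
      (Finite.injective_iff_bijective.mp fun i j h => hinj (Fin.mk.inj h))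
    refine ⟨Equiv.Perm.sign τ * ∏ i : Fin n, ∏ j ∈ Ioi i, (-1), fun x => ?_⟩
    have hM : (Matrix.of fun i j => x i ^ c j) = (Matrix.vandermonde x).submatrix id τ := by
      ext i j
      rfl
    rw [hdet, hM, Matrix.det_permute', Matrix.det_vandermonde, diffProd]
    push_cast
    rw [mul_assoc]
    congr 1
    simp only [← prod_mul_distrib]
    refine prod_congr rfl fun i _ => prod_congr rfl fun j _ => ?_
    ring
  · rw [Function.not_injective_iff] at hinj
    obtain ⟨i, j, hij, hne⟩ := hinj
    refine ⟨0, fun x => ?_⟩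
    rw [hdet, Matrix.det_zero_of_column_eq hne]
    · simp
    · intro k
      simp [hij]

theorem exists_altSum_aeval_eq {P : MvPolynomial (Fin n) K}
    (hP : P.IsHomogeneous (∑ i ∈ range n, i)) :
    ∃ a : K, altSum (fun x => aeval x P) (X : Fin n → MvPolynomial (Fin n) K) =
      C a * diffProd X := by
  have h : ∀ c : Fin n →₀ ℕ, ∃ ε : ℤ, c ∈ P.support →
      altSum (fun x => ∏ i, x i ^ c i) (X : Fin n → MvPolynomial (Fin n) K) =
        (ε : MvPolynomial (Fin n) K) * diffProd X := by
    intro c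
    by_cases hc : c ∈ P.support
    · have hdeg : ∑ i, c i = ∑ i ∈ range n, i := by
        rw [← Finsupp.degree_eq_sum]
        by_contra hne
        exact mem_support_iff.mp hc (hP.coeff_eq_zero hne)
      obtain ⟨ε, hε⟩ := exists_altSum_pow_eq (A := MvPolynomial (Fin n) K) hdeg
      exact ⟨ε, fun _ => hε X⟩
    · exact ⟨0, fun h => absurd h hc⟩
  choose ε hε using h
  refine ⟨∑ c ∈ P.support, coeff c P * ε c, ?_⟩
  rw [map_sum, sum_mul]
  have : ∀ c ∈ P.support, C (coeff c P * ε c) * diffProd X =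
      C (coeff c P) * altSum (fun x => ∏ i, x i ^ c i) (X : Fin n → MvPolynomial (Fin n) K) := by
    intro c hc
    rw [hε c hc, map_mul, map_intCast, mul_assoc]
  rw [sum_congr rfl this]
  simp only [altSum, mul_sum]
  rw [sum_comm]
  refine sum_congr rfl fun σ _ => ?_
  rw [aeval_def, eval₂_eq', mul_sum, algebraMap_eq]
  refine sum_congr rfl fun c _ => ?_
  ring

theorem map_altSum_aeval {A B : Type*} [CommRing A] [CommRing B] [Algebra K A] [Algebra K B]
    (φ : A →ₐ[K] B) (P : MvPolynomial (Fin n) K) (x : Fin n → A) :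
    φ (altSum (fun x => aeval x P) x) = altSum (fun x => aeval x P) (φ ∘ x) := by
  simp only [altSum, map_sum, map_mul, map_intCast]
  refine sum_congr rfl fun σ _ => ?_
  rw [← AlgHom.comp_apply, comp_aeval]
  rfl

theorem map_gapProd {A B : Type*} [CommRing A] [CommRing B] (φ : A →+* B) (q : A)
    (x : Fin n → A) : φ (gapProd q x) = gapProd (φ q) (φ ∘ x) := by
  simp only [gapProd, map_prod]
  refine prod_congr rfl fun i _ => prod_congr rfl fun j _ => ?_
  split_ifs <;> simp

theorem map_diffProd {A B : Type*} [CommRing A] [CommRing B] (φ : A →+* B)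
    (x : Fin n → A) : φ (diffProd x) = diffProd (φ ∘ x) := by
  simp [diffProd, map_prod]

theorem diffProd_cons_zero {A : Type*} [CommRing A] (y : Fin n → A) :
    diffProd (Fin.cons 0 y : Fin (n + 1) → A) = (-1) ^ n * (∏ j, y j) * diffProd y := by
  rw [diffProd, Fin.prod_univ_succ, Fin.prod_Ioi_zero]
  simp only [Fin.prod_Ioi_succ, Fin.cons_zero, Fin.cons_succ, zero_sub]
  rw [prod_neg, card_univ, Fintype.card_fin, diffProd]

theorem aeval_mul_gapProd {A : Type*} [CommRing A] [Algebra K A] (q : K)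
    (f : MvPolynomial (Fin n) K) (x : Fin n → A) :
    aeval x (f * gapProd (C q) X) = aeval x f * gapProd (algebraMap K A q) x := by
  rw [map_mul]
  congr 1
  have := map_gapProd (aeval x : MvPolynomial (Fin n) K →ₐ[K] A).toRingHom (C q) X
  refine this.trans ?_
  congr 1
  · exact aeval_C x q
  · ext i
    exact aeval_X x i

/-- Of all pairs i < j, exactly n are adjacent. This puts f · `gapProd` in the degree of the
Vandermonde product when f has degree n. -/
theorem sum_gap_count (n : ℕ) :
    n + ∑ i : Fin (n + 1), ∑ j : Fin (n + 1), (if (i : ℕ) + 1 < j then 1 else 0) =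
      ∑ i ∈ range (n + 1), i := by
  have hcol : ∀ j : Fin (n + 1), ∑ i : Fin (n + 1), (if (i : ℕ) + 1 < j then 1 else 0) =
      (j : ℕ) - 1 := by
    intro j
    rw [← Finset.sum_range (fun i => if i + 1 < (j : ℕ) then 1 else 0), ← sum_filter,
      ← card_eq_sum_ones]
    have : {i ∈ range (n + 1) | i + 1 < (j : ℕ)} = range ((j : ℕ) - 1) := by
      ext i
      simp only [mem_filter, mem_range]
      omega
    rw [this, card_range]
  rw [sum_comm, sum_congr rfl fun j _ => hcol j, ← Finset.sum_range (fun j => j - 1)]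
  clear hcol
  induction n with
  | zero => simp
  | succ n ih =>
    rw [sum_range_succ, sum_range_succ _ (n + 1)]
    omega

theorem diffProd_X_ne_zero : (diffProd X : MvPolynomial (Fin n) K) ≠ 0 := by
  refine prod_ne_zero_iff.mpr fun i _ => prod_ne_zero_iff.mpr fun j hj => ?_
  exact sub_ne_zero.mpr fun h => (mem_Ioi.mp hj).ne (X_injective h)

theorem isHomogeneous_gapProd (q : K) :
    (gapProd (C q) X : MvPolynomial (Fin (n + 1)) K).IsHomogeneous
      (∑ i : Fin (n + 1), ∑ j : Fin (n + 1), (if (i : ℕ) + 1 < j then 1 else 0)) := by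
  refine IsHomogeneous.prod _ _ _ fun i _ => IsHomogeneous.prod _ _ _ fun j _ => ?_
  split_ifs
  · exact ((zero_add 1) ▸ (isHomogeneous_C _ q).mul (isHomogeneous_X K i)).sub (isHomogeneous_X K j)
  · exact isHomogeneous_one _ _

/-- After summation by parts, the missing variable in `prodOmit z k` is supplied by R_{k+1} f - R_k
f = x_k T_k f, so the full product of the variables comes out. -/
theorem sum_aeval_insertNth_mul_gapProd (q : K) (f : MvPolynomial (Fin (n + 2)) K)
    {A : Type*} [CommRing A] [Algebra K A] (z : Fin (n + 1) → A) :
    ∑ p : Fin (n + 2), (-1) ^ (p : ℕ) *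
      aeval (Fin.insertNth (α := fun _ => A) p 0 z) (f * gapProd (C q) X) =
    (-1) ^ (n + 1) * (∏ j, z j) *
      aeval z ((∑ k : Fin (n + 1), q ^ (k : ℕ) • trim K k f) * gapProd (C q) X) := by
  have hins : ∀ p : Fin (n + 2), aeval (Fin.insertNth (α := fun _ => A) p 0 z) f =
      aeval z (insertZero K p f) := by
    intro p
    rw [insertZero, ← AlgHom.comp_apply, comp_aeval]
    refine congrArg (fun y => aeval y f) (funext fun i => ?_)
    rcases Fin.eq_self_or_eq_succAbove p i with rfl | ⟨j, rfl⟩ <;> simp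
  have hterm : ∀ p : Fin (n + 2), (-1) ^ (p : ℕ) *
      aeval (Fin.insertNth (α := fun _ => A) p 0 z) (f * gapProd (C q) X) =
      gapProd (algebraMap K A q) z * ((-1) ^ (p : ℕ) *
        (insertFactor (algebraMap K A q) p z * aeval z (insertZero K p f))) := by
    intro p
    rw [aeval_mul_gapProd, gapProd_insertNth, hins]
    ring
  have htrim : ∀ k : Fin (n + 1), algebraMap K A q ^ (k : ℕ) * prodOmit z k *
      (aeval z (insertZero K k.succ f) - aeval z (insertZero K k.castSucc f)) =
      (∏ j, z j) * aeval z (q ^ (k : ℕ) • trim K k f) := by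
    intro k
    rw [← map_sub, ← X_mul_trim, map_mul, aeval_X, ← mul_prodOmit z k, map_smul, Algebra.smul_def,
      map_pow]
    ring
  rw [sum_congr rfl fun p _ => hterm p, ← mul_sum, sum_insertFactor,
    sum_congr rfl fun k _ => htrim k, ← mul_sum, aeval_mul_gapProd, map_sum]
  ring

theorem aeval_cons_zero_altSum (q : K) (f : MvPolynomial (Fin (n + 2)) K) :
    aeval (Fin.cons 0 X : Fin (n + 2) → MvPolynomial (Fin (n + 1)) K)
      (altSum (fun x => aeval x (f * gapProd (C q) X))
        (X : Fin (n + 2) → MvPolynomial (Fin (n + 2)) K)) =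
    (-1) ^ (n + 1) * (∏ j, X j) *
      altSum (fun x => aeval x ((∑ k : Fin (n + 1), q ^ (k : ℕ) • trim K k f) * gapProd (C q) X))
        (X : Fin (n + 1) → MvPolynomial (Fin (n + 1)) K) := by
  set y : Fin (n + 2) → MvPolynomial (Fin (n + 1)) K := Fin.cons 0 X with hy
  have hyX : (aeval y : MvPolynomial (Fin (n + 2)) K →ₐ[K] _) ∘ X = y := by
    ext1 i
    exact aeval_X y i
  rw [map_altSum_aeval, hyX, hy, altSum_cons_zero]
  generalize hP : f * gapProd (C q) X = P
  generalize hQ : (∑ k : Fin (n + 1), q ^ (k : ℕ) • trim K k f) * gapProd (C q) X = Q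
  simp only [altSum, mul_sum]
  rw [sum_comm]
  refine sum_congr rfl fun σ _ => ?_
  have h := sum_aeval_insertNth_mul_gapProd q f
    ((X : Fin (n + 1) → MvPolynomial (Fin (n + 1)) K) ∘ σ)
  have hprod : ∏ j, ((X : Fin (n + 1) → MvPolynomial (Fin (n + 1)) K) ∘ σ) j = ∏ j, X j :=
    Equiv.prod_comp σ _
  rw [hprod, hP, hQ] at h
  rw [mul_left_comm, ← h, mul_sum]
  refine sum_congr rfl fun p _ => ?_
  rw [mul_left_comm]

theorem aeval_cons_zero_diffProd :
    aeval (Fin.cons 0 X : Fin (n + 1) → MvPolynomial (Fin n) K)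
      (diffProd (X : Fin (n + 1) → MvPolynomial (Fin (n + 1)) K)) =
    (-1) ^ n * (∏ j, X j) * diffProd X := by
  rw [← diffProd_cons_zero]
  set y : Fin (n + 1) → MvPolynomial (Fin n) K := Fin.cons 0 X with hy
  refine (map_diffProd (aeval y : MvPolynomial (Fin (n + 1)) K →ₐ[K] _).toRingHom X).trans ?_
  congr 1
  ext1 i
  exact aeval_X y i

theorem altSum_eq_trimFunctional_zero (q : K) {f : MvPolynomial (Fin 1) K}
    (hf : f.IsHomogeneous 0) : altSum (fun x => aeval x (f * gapProd (C q) X))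
      (X : Fin 1 → MvPolynomial (Fin 1) K) = C (trimFunctional q 0 f) * diffProd X := by
  have hfC : f = C (coeff 0 f) := totalDegree_eq_zero_iff_eq_C.mp
    ((totalDegree_zero_iff_isHomogeneous (Fin 1)).mpr hf)
  have hgap : (gapProd (C q) X : MvPolynomial (Fin 1) K) = 1 := by
    simp [gapProd]
  have hdiff : (diffProd X : MvPolynomial (Fin 1) K) = 1 := by
    simp [diffProd]
  change _ = C (coeff 0 f) * _
  rw [hgap, hdiff, altSum, mul_one, mul_one, Fintype.sum_unique, ← hfC]
  simp

/-- At x_0 = 0 both the alternating sum and the Vandermonde product acquire the same nonzero factor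
(-1)^(n+1) ∏ x_j, which cancels and leaves the inductive statement for ∑ q^k T_k f. -/
theorem altSum_eq_trimFunctional (q : K) (n : ℕ) {f : MvPolynomial (Fin (n + 1)) K}
    (hf : f.IsHomogeneous n) : altSum (fun x => aeval x (f * gapProd (C q) X))
      (X : Fin (n + 1) → MvPolynomial (Fin (n + 1)) K) = C (trimFunctional q n f) * diffProd X := by
  induction n with
  | zero => exact altSum_eq_trimFunctional_zero q hf
  | succ n ih =>
    obtain ⟨a, ha⟩ := exists_altSum_aeval_eq (P := f * gapProd (C q) X) (by
      rw [← sum_gap_count (n + 1)]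
      exact hf.mul (isHomogeneous_gapProd q))
    have h1 := aeval_cons_zero_altSum q f
    set g := ∑ k : Fin (n + 1), q ^ (k : ℕ) • trim K k f with hg
    have hghom : g.IsHomogeneous n := IsHomogeneous.sum _ _ _ fun k _ =>
      (homogeneousSubmodule (Fin (n + 1)) K n).smul_mem _ (isHomogeneous_trim k hf)
    have hΛ : trimFunctional q (n + 1) f = trimFunctional q n g := by
      rw [trimFunctional_succ, hg, map_sum]
      simp
    rw [ih hghom, ha, map_mul, aeval_cons_zero_diffProd, aeval_C, algebraMap_eq] at h1
    have hX : (∏ j, X j : MvPolynomial (Fin (n + 1)) K) ≠ 0 :=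
      prod_ne_zero_iff.mpr fun j _ => X_ne_zero j
    have h2 : (-1) ^ (n + 1) * (∏ j, X j) * (diffProd X : MvPolynomial (Fin (n + 1)) K) ≠ 0 :=
      mul_ne_zero (mul_ne_zero (pow_ne_zero _ (neg_ne_zero.mpr one_ne_zero)) hX)
        diffProd_X_ne_zero
    have h3 : (C a : MvPolynomial (Fin (n + 1)) K) = C (trimFunctional q n g) := by
      apply mul_right_cancel₀ h2
      rw [h1]
      ring
    rw [ha, hΛ, C_injective _ _ h3]

end

/-! ### Return to rational functions -/

section

variable {K : Type*} [Field K] {n : ℕ}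

theorem prod_Ioi_eq_prod_adjacent_mul {A : Type*} [CommRing A] (t : Fin (n + 1) → Fin (n + 1) → A) :
    ∏ i, ∏ j ∈ Ioi i, t i j = (∏ i : Fin n, t i.castSucc i.succ) *
      ∏ i : Fin (n + 1), ∏ j : Fin (n + 1), if (i : ℕ) + 1 < j then t i j else 1 := by
  have hadj : ∏ i : Fin (n + 1), ∏ j : Fin (n + 1), (if (i : ℕ) + 1 = j then t i j else 1) =
      ∏ i : Fin n, t i.castSucc i.succ := by
    rw [Fin.prod_univ_castSucc]
    have hlast : ∏ j : Fin (n + 1),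
        (if (Fin.last n : ℕ) + 1 = j then t (Fin.last n) j else 1) = 1 :=
      prod_eq_one fun j _ => if_neg (by rw [Fin.val_last]; omega)
    rw [hlast, mul_one]
    refine prod_congr rfl fun i _ => ?_
    rw [prod_eq_single i.succ, if_pos (by simp)]
    · exact fun j _ hj => if_neg fun h => hj (Fin.ext (by simpa using h.symm))
    · simp
  rw [← hadj, ← prod_mul_distrib]
  refine prod_congr rfl fun i _ => ?_
  rw [← prod_mul_distrib, ← prod_subset (subset_univ (Ioi i))]
  · refine prod_congr rfl fun j hj => ?_
    rw [mem_Ioi, Fin.lt_def] at hj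
    rcases Nat.eq_or_lt_of_le (Nat.succ_le_of_lt hj) with h | h
    · rw [if_pos h, if_neg (by omega), mul_one]
    · rw [if_neg (by omega), if_pos h, one_mul]
  · intro j _ hj
    rw [mem_Ioi, Fin.lt_def] at hj
    rw [if_neg (by omega), if_neg (by omega), mul_one]

theorem permAct_algebraMap (σ : Equiv.Perm (Fin n)) (P : MvPolynomial (Fin n) K) :
    permAct K σ (algebraMap (MvPolynomial (Fin n) K) (RatFun K n) P) =
      algebraMap (MvPolynomial (Fin n) K) (RatFun K n) (aeval (X ∘ σ) P) := by
  rw [permAct, IsFractionRing.ringEquivOfRingEquiv_algebraMap]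
  exact congrArg _ (DFunLike.congr_fun (rename_eq_aeval σ) P)

theorem dividedDiffLongest_algebraMap (P : MvPolynomial (Fin n) K) :
    dividedDiffLongest (algebraMap (MvPolynomial (Fin n) K) (RatFun K n) P) =
      algebraMap (MvPolynomial (Fin n) K) (RatFun K n) (altSum (fun x => aeval x P) X) /
        algebraMap (MvPolynomial (Fin n) K) (RatFun K n) (diffProd X) := by
  simp only [dividedDiffLongest, permAct_algebraMap, altSum, diffProd, map_sum, map_mul, map_prod,
    map_sub, map_intCast, ratX]

/-- The coefficient of x_j is -1 for every q, so q = 0 needs no separate treatment. -/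
theorem qForm_poly_ne_zero (q : K) {i j : Fin n} (h : i ≠ j) :
    (C q * X i - X j : MvPolynomial (Fin n) K) ≠ 0 := by
  intro h0
  have := congrArg (coeff (Finsupp.single j 1)) h0
  rw [coeff_sub, coeff_C_mul, coeff_X, coeff_X, if_neg] at this
  · simp at this
  · rw [Finsupp.single_left_inj one_ne_zero]
    exact h

theorem qds_eq_trimFunctional (q : K) {f : MvPolynomial (Fin (n + 1)) K} (hf : f.IsHomogeneous n) :
    qds q f = algebraMap (MvPolynomial (Fin (n + 1)) K) (RatFun K (n + 1))
      (C (trimFunctional q n f)) := by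
  set ι := algebraMap (MvPolynomial (Fin (n + 1)) K) (RatFun K (n + 1)) with hι
  have hinj : Function.Injective ι := IsFractionRing.injective _ _
  set D : MvPolynomial (Fin (n + 1)) K := ∏ i : Fin n, (C q * X i.castSucc - X i.succ) with hD
  have hD0 : ι D ≠ 0 := by
    rw [map_ne_zero_iff _ hinj, hD]
    exact prod_ne_zero_iff.mpr fun i _ => qForm_poly_ne_zero q (Fin.castSucc_lt_succ).ne
  have hden : (∏ i : Fin (n + 1 - 1), qForm q (⟨i, by omega⟩ : Fin (n + 1)) ⟨i + 1, by omega⟩) =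
      ι D := by
    rw [hD, map_prod]
    rfl
  have hnum : (∏ i : Fin (n + 1), ∏ j ∈ Ioi i, qForm q i j) = ι D * ι (gapProd (C q) X) := by
    rw [← map_mul, hD, gapProd, ← prod_Ioi_eq_prod_adjacent_mul fun i j => C q * X i - X j]
    simp only [map_prod]
    rfl
  -- The adjacent factors cancel the denominator, so the argument of the divided difference is a
  -- polynomial.
  have hprod : ι D * ι (gapProd (C q) X) * (ι f / ι D) = ι (f * gapProd (C q) X) := by
    rw [map_mul]
    field_simp
  rw [qds, squareLongest, hden, hnum, hprod, dividedDiffLongest_algebraMap,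
    altSum_eq_trimFunctional q n hf, map_mul, mul_div_assoc, div_self, mul_one]
  exact (map_ne_zero_iff _ hinj).mpr diffProd_X_ne_zero

end

end

theorem theorem5p6 {K : Type*} [Field K] [CharZero K] (q : K)
    (hq : ∀ m : ℕ, 0 < m → q ^ m = 1 → q = 1) (n : ℕ) (hn : 0 < n) :
    (∀ f g h : MvPolynomial (Fin n) K, f.IsHomogeneous (n - 1) →
      g ∈ abbSpan K n → h ∈ qsymPlus K n → f = g + h →
      qds q f =
        algebraMap (MvPolynomial (Fin n) K) (RatFun K n)
          (MvPolynomial.C (MvPolynomial.eval (fun i : Fin n => q ^ (i : ℕ)) g))) ∧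
    (∀ (c : Fin n →₀ ℕ) (hc : c ∈ abbSet n) (hdeg : ∑ i, c i = n - 1),
      qds q (MvPolynomial.monomial c (1 : K)) =
        algebraMap (MvPolynomial (Fin n) K) (RatFun K n)
          (MvPolynomial.C (q ^ coarea (abbDyck c hc hdeg)))) := by
  obtain _ | n := n
  · omega
  have key : ∀ f g h : MvPolynomial (Fin (n + 1)) K, f.IsHomogeneous n →
      g ∈ abbSpan K (n + 1) → h ∈ qsymPlus K (n + 1) → f = g + h →
      qds q f = algebraMap (MvPolynomial (Fin (n + 1)) K) (RatFun K (n + 1))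
        (C (eval (fun i : Fin (n + 1) => q ^ (i : ℕ)) g)) := fun f g h hf hg hh hfgh => by
    rw [qds_eq_trimFunctional q hf, trimFunctional_eq_eval_of_eq_add q hf hg hh hfgh]
  refine ⟨key, fun c hc hdeg => ?_⟩
  -- An ABB monomial is its own normal form: take g to be the monomial and h = 0.
  rw [key _ (monomial c 1) 0 (isHomogeneous_monomial _ ((Finsupp.degree_eq_sum c).trans hdeg))
    (Submodule.subset_span ⟨c, hc, rfl⟩) (zero_mem _) (add_zero _).symm,
    eval_monomial_eq_pow_coarea q c hc hdeg]
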